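/- Let $\mathcal M$ be a finite tetrahedral mesh in $\mathbb R^3$, i.e. a finite (face-to-face) geometric simplicial complex in which every simplex is a face of a tetrahedron of the complex. For a tetrahedron $t$ let $R(t)$ be the radius of its circumsphere and $r(t)$ the radius of its insphere, and suppose that $\mathcal M$ is well-shaped with constant $\rho$, i.e. $R(t)/r(t)<\rho$ for every tetrahedron $t$ of $\mathcal M$. Let $q\in\mathbb R^3$ be a query point and let $p$ be a nearest neighbour of $q$ among the vertices of $\mathcal M$, i.e. $|pq|\le|vq|$ for every vertex $v$ of $\mathcal M$. Suppose that the straight segment $pq$ is contained in the union of the tetrahedra of $\mathcal M$ (for instance, that $q$ lies in a tetrahedron of $\mathcal M$ and the union of the tetrahedra is convex). Then the number of tetrahedra of $\mathcal M$ that meet the closed segment $pq$ is at most $$\frac{\sqrt{3}\,\pi}{486}\,\rho^3(\rho^2+3)^3 .$$ -/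

import Mathlib

namespace TetMesh

/-- Euclidean three-space. -/
abbrev E3 : Type := EuclideanSpace ℝ (Fin 3)

/-- A (finite, face-to-face) tetrahedral mesh: a finite geometric simplicial complex in `ℝ³`, all of
whose simplices are faces of tetrahedra (simplices with four vertices) of the complex. -/
structure IsTetrahedralMesh (M : Geometry.SimplicialComplex ℝ E3) : Prop where
  finite : M.faces.Finite
  pure : ∀ s ∈ M.faces, ∃ t ∈ M.faces, s ⊆ t ∧ t.card = 4

/-- The tetrahedra of the mesh, each given by its set of four vertices. -/
def tetrahedra (M : Geometry.SimplicialComplex ℝ E3) : Set (Finset E3) :=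
  {t | t ∈ M.faces ∧ t.card = 4}

/-- The mesh is well-shaped with bound `ρ`: for every tetrahedron the ratio of the circumradius to
the inradius is less than `ρ`. (`T` ranges over the orderings of the four vertices of `t`; the
two radii do not depend on the ordering, and orderings exist since `t` is affinely independent.) -/
def WellShaped (M : Geometry.SimplicialComplex ℝ E3) (ρ : ℝ) : Prop :=
  ∀ t ∈ tetrahedra M, ∀ T : Affine.Simplex ℝ E3 3, Set.range T.points = (t : Set E3) →
    T.circumradius / T.inradius < ρ

/-- `p` is a nearest neighbour of `q` among the vertices of the mesh. -/
def IsNearestVertex (M : Geometry.SimplicialComplex ℝ E3) (p q : E3) : Prop :=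
  p ∈ M.vertices ∧ ∀ v ∈ M.vertices, dist p q ≤ dist v q

/-- The tetrahedra that (as closed solids) meet the closed segment `pq`. -/
def visited (M : Geometry.SimplicialComplex ℝ E3) (p q : E3) : Set (Finset E3) :=
  {t | t ∈ tetrahedra M ∧ (convexHull ℝ (t : Set E3) ∩ segment ℝ p q).Nonempty}

end TetMesh

/-!
Write `R`, `r` and `h` for circumradius, inradius and heights of a tetrahedron, and `L = |pq|`. The
count rests on a packing argument. A tetrahedron that contains a point `x` can be shrunk by a
homothety about `x` without leaving itself. If all the tetrahedra in question have inradius at least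
`r₀` and meet a ball of radius `D`, shrink each to inradius exactly `r₀`: the inscribed balls are
pairwise disjoint and lie in a ball of radius `D + reach ρ * r₀`, so their number is at most
`(D / r₀ + reach ρ) ^ 3` (`card_mul_pow_le_of_inradius_ge`). Here `reach ρ` bounds the distance from
a point of a tetrahedron to the farthest point of its inscribed ball, in units of its inradius; it
comes from `|OI|² ≤ R² - 9 r²` (`dist_incenter_circumcenter_sq_le`), which also gives `3 < ρ`.

For the tetrahedra with vertex `p`, take `D = 0` and for `r₀` their smallest inradius: there are at
most `(reach ρ) ^ 3` of them (`card_le_reach_pow_of_mem`).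

For the others, let `T` be a tetrahedron with vertex `p` in which the segment `pq` starts, and let
`y` be the point where the segment meets the face of `T` opposite `p`; if there is no such point,
then every tetrahedron that meets `pq` has the vertex `p`. Put `d = |py|`, which is at least a
height of `T`, hence more than `2 r(T)`. All vertices have distance at least `L` from `q`, so the parallel
axis theorem at `y` gives `L² ≤ (L - d)² + R(T)²`, and therefore `L / d ≤ (1 + ρ² / 4) / 2`. A
tetrahedron without the vertex `p` meets the segment only at points `x` with `|px| ≥ d`. Its
vertices have distance at least `|px|` from `x`, which forces `R ≥ d` and `r ≥ d / ρ`. Packing with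
`r₀ = d / ρ` and `D = L / 2` about the midpoint of `pq` gives at most
`(ρ³ / 16 + ρ / 4 + reach ρ) ^ 3` such tetrahedra (`card_le_of_notMem`).

The sum of the two numbers is at most `(2 / 9 * ρ * (ρ² + 3)) ^ 3` for `ρ ≥ 3`, and
`(2 / 9) ^ 3 = 16 / 3 / 486 ≤ √3 π / 486`.
-/

open MeasureTheory

namespace TetMesh

/-! ### Metric geometry of a tetrahedron -/

/-- The vertices of a tetrahedron in space, as an affine basis: its coordinates are the barycentric
coordinates. -/
noncomputable def baryBasis (T : Affine.Simplex ℝ E3 3) : AffineBasis (Fin 4) ℝ E3 where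
  toFun := T.points
  ind' := T.independent
  tot' := by
    rw [T.independent.affineSpan_eq_top_iff_card_eq_finrank_add_one]
    simp

@[simp] lemma baryBasis_apply (T : Affine.Simplex ℝ E3 3) (i : Fin 4) :
    baryBasis T i = T.points i := rfl

lemma coe_baryBasis (T : Affine.Simplex ℝ E3 3) : ⇑(baryBasis T) = T.points := rfl

lemma sum_coord_smul (T : Affine.Simplex ℝ E3 3) (x : E3) :
    ∑ i, (baryBasis T).coord i x • T.points i = x :=
  (baryBasis T).linear_combination_coord_eq_self x

lemma mem_convexHull_iff_coord_nonneg (T : Affine.Simplex ℝ E3 3) (x : E3) :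
    x ∈ convexHull ℝ (Set.range T.points) ↔ ∀ i, 0 ≤ (baryBasis T).coord i x := by
  have := (baryBasis T).convexHull_eq_nonneg_coord
  rw [coe_baryBasis] at this
  rw [this]; rfl

lemma signedInfDist_eq_coord_mul_height (T : Affine.Simplex ℝ E3 3) (i : Fin 4) (x : E3) :
    T.signedInfDist i x = (baryBasis T).coord i x * T.height i := by
  have h := T.signedInfDist_affineCombination i (w := fun j => (baryBasis T).coord j x)
    ((baryBasis T).sum_coord_apply_eq_one x)
  have h2 := (baryBasis T).affineCombination_coord_eq_self x
  rw [coe_baryBasis] at h2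
  rw [h2] at h
  rw [h, Affine.Simplex.height, dist_eq_norm_vsub E3, Affine.Simplex.altitudeFoot]

/-- A barycentric coordinate times the corresponding height is a `1`-Lipschitz function, being the
signed distance to a face. -/
lemma abs_coord_sub_mul_height_le_dist (T : Affine.Simplex ℝ E3 3) (i : Fin 4) (x y : E3) :
    |((baryBasis T).coord i x - (baryBasis T).coord i y) * T.height i| ≤ dist x y := by
  rw [sub_mul, ← signedInfDist_eq_coord_mul_height, ← signedInfDist_eq_coord_mul_height,
    Affine.Simplex.signedInfDist, AffineSubspace.signedInfDist_def, signedDist_triangle_left,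
    dist_comm x y]
  exact abs_signedDist_le_dist _ _ _

lemma coord_incenter_mul_height (T : Affine.Simplex ℝ E3 3) (i : Fin 4) :
    (baryBasis T).coord i T.incenter * T.height i = T.inradius := by
  rw [← signedInfDist_eq_coord_mul_height, T.signedInfDist_incenter]

lemma closedBall_incenter_subset_convexHull (T : Affine.Simplex ℝ E3 3) :
    Metric.closedBall T.incenter T.inradius ⊆ convexHull ℝ (Set.range T.points) := by
  intro x hx
  rw [mem_convexHull_iff_coord_nonneg]
  intro i
  have h1 := abs_coord_sub_mul_height_le_dist T i x T.incenter
  have h2 := coord_incenter_mul_height T i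
  have h3 := T.height_pos i
  rw [Metric.mem_closedBall] at hx
  rw [sub_mul, h2] at h1
  have := (abs_le.1 (h1.trans hx)).1
  exact nonneg_of_mul_nonneg_left (by linarith) h3

/-- The parallel axis theorem (Leibniz) for a weighted system of points. -/
lemma sum_mul_dist_sq {ι : Type*} (s : Finset ι) (w : ι → ℝ) (v : ι → E3) (x z : E3)
    (hw : ∑ i ∈ s, w i = 1) (hx : ∑ i ∈ s, w i • v i = x) :
    ∑ i ∈ s, w i * dist (v i) z ^ 2 = dist x z ^ 2 + ∑ i ∈ s, w i * dist (v i) x ^ 2 := by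
  have h0 : ∑ i ∈ s, w i • (v i - x) = 0 := by
    simp only [smul_sub, Finset.sum_sub_distrib, hx, ← Finset.sum_smul, hw, one_smul, sub_self]
  have h1 : ∑ i ∈ s, w i * inner ℝ (v i - x) (x - z) = 0 := by
    rw [← inner_zero_left (𝕜 := ℝ) (x - z), ← h0, sum_inner]
    exact Finset.sum_congr rfl fun i _ => by rw [real_inner_smul_left]
  have h2 : ∀ i, w i * dist (v i) z ^ 2 =
      w i * dist x z ^ 2 + w i * dist (v i) x ^ 2 + 2 * (w i * inner ℝ (v i - x) (x - z)) := by
    intro i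
    have : v i - z = (v i - x) + (x - z) := by abel
    rw [dist_eq_norm, dist_eq_norm, dist_eq_norm, this, norm_add_sq_real]
    ring
  simp only [h2, Finset.sum_add_distrib, ← Finset.sum_mul, ← Finset.mul_sum, hw, h1]
  ring

lemma dist_point_circumcenter (T : Affine.Simplex ℝ E3 3) (i : Fin 4) :
    dist (T.points i) T.circumcenter = T.circumradius :=
  T.dist_circumcenter_eq_circumradius i

lemma sum_coord_mul_dist_sq (T : Affine.Simplex ℝ E3 3) (x z : E3) :
    ∑ i, (baryBasis T).coord i x * dist (T.points i) z ^ 2 =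
      dist x z ^ 2 + (T.circumradius ^ 2 - dist x T.circumcenter ^ 2) := by
  have h1 := sum_mul_dist_sq Finset.univ (fun i => (baryBasis T).coord i x) T.points x z
    ((baryBasis T).sum_coord_apply_eq_one x) (sum_coord_smul T x)
  have h2 := sum_mul_dist_sq Finset.univ (fun i => (baryBasis T).coord i x) T.points x
    T.circumcenter ((baryBasis T).sum_coord_apply_eq_one x) (sum_coord_smul T x)
  simp only [dist_point_circumcenter, ← Finset.sum_mul,
    (baryBasis T).sum_coord_apply_eq_one x] at h2
  linarith

/-- If a tetrahedron contains `x` and all its vertices have distance at least `δ` from `z`, then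
the power of `x` with respect to the circumsphere forces `δ² ≤ |xz|² + R²`. -/
lemma sq_le_dist_sq_add_circumradius_sq (T : Affine.Simplex ℝ E3 3) {x z : E3} {δ : ℝ}
    (hδ : 0 ≤ δ) (hx : x ∈ convexHull ℝ (Set.range T.points))
    (hz : ∀ i, δ ≤ dist (T.points i) z) : δ ^ 2 ≤ dist x z ^ 2 + T.circumradius ^ 2 := by
  rw [mem_convexHull_iff_coord_nonneg] at hx
  have h : ∑ i, (baryBasis T).coord i x * δ ^ 2 ≤
      ∑ i, (baryBasis T).coord i x * dist (T.points i) z ^ 2 :=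
    Finset.sum_le_sum fun i _ =>
      mul_le_mul_of_nonneg_left (pow_le_pow_left₀ hδ (hz i) 2) (hx i)
  rw [← Finset.sum_mul, (baryBasis T).sum_coord_apply_eq_one, one_mul,
    sum_coord_mul_dist_sq] at h
  nlinarith [sq_nonneg (dist x T.circumcenter)]

lemma dist_circumcenter_le (T : Affine.Simplex ℝ E3 3) {x : E3}
    (hx : x ∈ convexHull ℝ (Set.range T.points)) : dist x T.circumcenter ≤ T.circumradius := by
  have : convexHull ℝ (Set.range T.points) ⊆ Metric.closedBall T.circumcenter T.circumradius := by
    refine convexHull_min ?_ (convex_closedBall _ _)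
    rintro _ ⟨i, rfl⟩
    exact (dist_point_circumcenter T i).le
  exact this hx

/-- A bound for the distance between the circumcenter `O` and the incenter `I`. By the parallel axis
theorem `R² - |OI|² = ∑ cᵢ |vᵢ I|²`, where the barycentric coordinates `cᵢ = r / hᵢ` of `I` sum to
`1` and `|vᵢ I| ≥ hᵢ - r`, so that each term is at least `r² (1 - cᵢ)² / cᵢ`, a convex function
of `cᵢ`. -/
lemma dist_incenter_circumcenter_sq_le (T : Affine.Simplex ℝ E3 3) :
    dist T.incenter T.circumcenter ^ 2 ≤ T.circumradius ^ 2 - 9 * T.inradius ^ 2 := by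
  have h1 := sum_coord_mul_dist_sq T T.incenter T.incenter
  have hsum := (baryBasis T).sum_coord_apply_eq_one T.incenter
  have hr := T.inradius_pos
  -- The tangent line of `c ↦ r² (1 - c)² / c` at the centroid value `c = 1 / 4`.
  have key : ∀ i, T.inradius ^ 2 * (6 - 15 * (baryBasis T).coord i T.incenter) ≤
      (baryBasis T).coord i T.incenter * dist (T.points i) T.incenter ^ 2 := by
    intro i
    have h2 := abs_coord_sub_mul_height_le_dist T i (T.points i) T.incenter
    have h3 := coord_incenter_mul_height T i
    have h4 := T.height_pos i
    have h5 : (baryBasis T).coord i (T.points i) = 1 := (baryBasis T).coord_apply_eq i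
    rw [h5] at h2
    set c := (baryBasis T).coord i T.incenter
    set h := T.height i
    have hc : 0 < c := by
      by_contra hc
      nlinarith
    have h6 : ((1 - c) * h) ^ 2 ≤ dist (T.points i) T.incenter ^ 2 := by
      rw [← sq_abs]; exact pow_le_pow_left₀ (abs_nonneg _) h2 2
    have h7 : c * ((1 - c) * h) ^ 2 ≤ c * dist (T.points i) T.incenter ^ 2 :=
      mul_le_mul_of_nonneg_left h6 hc.le
    refine le_trans ?_ h7
    rw [← h3]
    have : c * ((1 - c) * h) ^ 2 - (c * h) ^ 2 * (6 - 15 * c) =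
        c * h ^ 2 * (4 * c - 1) ^ 2 := by
      ring
    nlinarith [mul_nonneg (mul_nonneg hc.le (sq_nonneg h)) (sq_nonneg (4 * c - 1))]
  have h8 := Finset.sum_le_sum fun i (_ : i ∈ Finset.univ) => key i
  rw [← Finset.mul_sum, h1, Finset.sum_sub_distrib, ← Finset.mul_sum, hsum, dist_self] at h8
  norm_num at h8
  linarith

lemma three_mul_inradius_le_circumradius (T : Affine.Simplex ℝ E3 3) :
    3 * T.inradius ≤ T.circumradius := by
  have := dist_incenter_circumcenter_sq_le T
  have hr := T.inradius_pos
  have hR := T.circumradius_nonneg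
  nlinarith [sq_nonneg (dist T.incenter T.circumcenter)]

/-- An upper bound, for a tetrahedron with `R / r ≤ ρ`, for the distance, in units of `r`, from a
point of the tetrahedron to the farthest point of the inscribed ball. It replaces the square root in
`ρ + √(ρ² - 9) + 1` by its tangent line in `ρ²` at `ρ² = 45 / 4`. -/
noncomputable def reach (ρ : ℝ) : ℝ := ρ + 1 + (ρ ^ 2 - 27 / 4) / 3

lemma dist_incenter_add_inradius_le (T : Affine.Simplex ℝ E3 3) {ρ : ℝ}
    (hT : T.circumradius ≤ ρ * T.inradius) {x : E3}
    (hx : x ∈ convexHull ℝ (Set.range T.points)) :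
    dist x T.incenter + T.inradius ≤ reach ρ * T.inradius := by
  have h1 := dist_circumcenter_le T hx
  have h2 := dist_incenter_circumcenter_sq_le T
  have h3 := three_mul_inradius_le_circumradius T
  have hr := T.inradius_pos
  have h4 : dist x T.incenter ≤ dist x T.circumcenter + dist T.incenter T.circumcenter := by
    rw [dist_comm T.incenter]; exact dist_triangle _ _ _
  have h5 : 3 ≤ ρ := by
    by_contra h
    nlinarith
  have h6 : dist T.incenter T.circumcenter ≤ (ρ ^ 2 - 27 / 4) / 3 * T.inradius := by
    refine abs_le_of_sq_le_sq' ?_ (mul_nonneg (by nlinarith) hr.le) |>.2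
    have h7 : T.circumradius ^ 2 ≤ (ρ * T.inradius) ^ 2 := by
      exact pow_le_pow_left₀ T.circumradius_nonneg hT 2
    nlinarith [mul_nonneg (sq_nonneg (ρ ^ 2 - 45 / 4)) (sq_nonneg T.inradius)]
  rw [reach]
  linarith

lemma two_mul_inradius_lt_height (T : Affine.Simplex ℝ E3 3) (i : Fin 4) :
    2 * T.inradius < T.height i := by
  have h1 := T.excenterWeights_empty_lt_inv_two i
  have h2 : (baryBasis T).coord i T.incenter = T.excenterWeights ∅ i := by
    rw [T.incenter_eq_affineCombination, ← coe_baryBasis]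
    exact (baryBasis T).coord_apply_combination_of_mem (Finset.mem_univ i)
      T.excenterExists_empty.sum_excenterWeights_eq_one
  have h3 := coord_incenter_mul_height T i
  rw [h2] at h3
  nlinarith [T.height_pos i]

/-! ### Packing -/

/-- Comparison of volumes for disjoint balls of radius `r` inside a ball of radius `X`. -/
lemma card_mul_pow_le_of_disjoint_balls {ι : Type*} (S : Finset ι) (hS : S.Nonempty)
    (c : ι → E3) (z : E3) {r X : ℝ} (hr : 0 < r)
    (hdis : (S : Set ι).PairwiseDisjoint fun i => Metric.ball (c i) r)
    (hX : ∀ i ∈ S, dist (c i) z + r ≤ X) : (S.card : ℝ) * r ^ 3 ≤ X ^ 3 := by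
  obtain ⟨i₀, hi₀⟩ := hS
  have hX0 : 0 < X := by
    have := hX i₀ hi₀
    have := dist_nonneg (x := c i₀) (y := z)
    linarith
  have hsub : (⋃ i ∈ S, Metric.ball (c i) r) ⊆ Metric.ball z X := by
    refine Set.iUnion₂_subset fun i hi => Metric.ball_subset_ball' ?_
    linarith [hX i hi]
  have h1 : volume (⋃ i ∈ S, Metric.ball (c i) r) = ∑ i ∈ S, volume (Metric.ball (c i) r) :=
    measure_biUnion_finset hdis fun i _ => measurableSet_ball
  have h2 : (∑ i ∈ S, volume (Metric.ball (c i) r)) ≤ volume (Metric.ball z X) :=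
    h1 ▸ measure_mono hsub
  have h3 : (volume : Measure E3).real (Metric.ball 0 1) * (S.card * r ^ 3) ≤
      (volume : Measure E3).real (Metric.ball 0 1) * X ^ 3 := by
    have h4 := ENNReal.toReal_mono measure_ball_lt_top.ne h2
    rw [ENNReal.toReal_sum fun i _ => measure_ball_lt_top.ne] at h4
    have h5 : ∀ (x : E3) {s : ℝ}, 0 < s → (volume (Metric.ball x s)).toReal =
        s ^ 3 * (volume : Measure E3).real (Metric.ball 0 1) := by
      intro x s hs
      rw [Measure.addHaar_ball_of_pos _ _ hs, ENNReal.toReal_mul,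
        ENNReal.toReal_ofReal (by positivity)]
      simp [Measure.real]
    simp only [h5 _ hr, h5 _ hX0, Finset.sum_const, nsmul_eq_mul] at h4
    linarith
  refine le_of_mul_le_mul_left h3 ?_
  exact ENNReal.toReal_pos (Metric.measure_ball_pos _ _ one_pos).ne' measure_ball_lt_top.ne

/-- The solids of two distinct tetrahedra of a complex have disjoint interiors. -/
lemma disjoint_of_isOpen_subset_convexHull (M : Geometry.SimplicialComplex ℝ E3) {s t : Finset E3}
    (hs : s ∈ tetrahedra M) (ht : t ∈ tetrahedra M) (hst : s ≠ t) {U V : Set E3}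
    (hU : IsOpen U) (hV : IsOpen V) (hUs : U ⊆ convexHull ℝ (s : Set E3))
    (hVt : V ⊆ convexHull ℝ (t : Set E3)) : Disjoint U V := by
  rw [Set.disjoint_iff_inter_eq_empty]
  by_contra hne
  have hne : (U ∩ V).Nonempty := Set.nonempty_iff_ne_empty.2 hne
  have hsub : U ∩ V ⊆ convexHull ℝ (s ∩ t : Set E3) := fun x hx =>
    M.inter_subset_convexHull hs.1 ht.1 ⟨hUs hx.1, hVt hx.2⟩
  have hint : (interior (convexHull ℝ (s ∩ t : Set E3))).Nonempty :=
    hne.mono (interior_maximal hsub (hU.inter hV))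
  rw [interior_convexHull_nonempty_iff_affineSpan_eq_top] at hint
  obtain ⟨v, hvs, hvt⟩ : ∃ v ∈ s, v ∉ t := by
    by_contra! h
    exact hst (Finset.eq_of_subset_of_card_le h (by rw [hs.2, ht.2]))
  have hmem := (M.indep hs.1).mem_affineSpan_iff ⟨v, hvs⟩ {w | (w : E3) ∈ t}
  have himg : ((↑) : s → E3) '' {w | (w : E3) ∈ t} = (s ∩ t : Set E3) := by
    ext x
    simp [and_comm]
  rw [himg, hint] at hmem
  exact hvt (hmem.1 (AffineSubspace.mem_top ℝ E3 v))

lemma exists_simplex_range_eq (M : Geometry.SimplicialComplex ℝ E3) {t : Finset E3}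
    (ht : t ∈ tetrahedra M) :
    ∃ T : Affine.Simplex ℝ E3 3, Set.range T.points = (t : Set E3) := by
  refine ⟨⟨((↑) : t → E3) ∘ (t.equivFinOfCardEq ht.2).symm,
    (M.indep ht.1).comp_embedding (t.equivFinOfCardEq ht.2).symm.toEmbedding⟩, ?_⟩
  simp [Set.range_comp]

lemma WellShaped.circumradius_lt {M : Geometry.SimplicialComplex ℝ E3} {ρ : ℝ}
    (hρ : WellShaped M ρ) {t : Finset E3} (ht : t ∈ tetrahedra M) {T : Affine.Simplex ℝ E3 3}
    (hT : Set.range T.points = (t : Set E3)) : T.circumradius < ρ * T.inradius :=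
  (div_lt_iff₀ T.inradius_pos).1 (hρ t ht T hT)

/-- Many tetrahedra of inradius at least `r` cannot all come within distance `D` of `z`: each one is
shrunk, by a homothety centred at its point close to `z`, to inradius exactly `r`, and the inscribed
balls of the shrunk tetrahedra are disjoint. -/
lemma card_mul_pow_le_of_inradius_ge (M : Geometry.SimplicialComplex ℝ E3) {ρ : ℝ}
    (hρ : WellShaped M ρ) (S : Finset (Finset E3)) (hne : S.Nonempty)
    (hS : ∀ t ∈ S, t ∈ tetrahedra M) (z : E3)
    {r D : ℝ} (hr : 0 < r)
    (h : ∀ t ∈ S, ∃ T : Affine.Simplex ℝ E3 3, Set.range T.points = (t : Set E3) ∧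
      r ≤ T.inradius ∧ ∃ x ∈ convexHull ℝ (t : Set E3), dist x z ≤ D) :
    (S.card : ℝ) * r ^ 3 ≤ (D + reach ρ * r) ^ 3 := by
  have hball : ∀ t ∈ S, ∃ c : E3, Metric.ball c r ⊆ convexHull ℝ (t : Set E3) ∧
      dist c z + r ≤ D + reach ρ * r := by
    intro t ht
    obtain ⟨T, hT, hrT, x, hx, hxz⟩ := h t ht
    have hr' := T.inradius_pos
    have hR : T.circumradius ≤ ρ * T.inradius := by
      exact (hρ.circumradius_lt (hS t ht) hT).le
    have hreach := dist_incenter_add_inradius_le T hR (hT ▸ hx)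
    -- the ratio of the homothety
    set k := r / T.inradius with hk
    have hk0 : 0 < k := by positivity
    have hk1 : k ≤ 1 := (div_le_one hr').2 hrT
    have hkr : k * T.inradius = r := div_mul_cancel₀ _ hr'.ne'
    refine ⟨AffineMap.homothety x k T.incenter, ?_, ?_⟩
    · intro y hy
      have hy' : AffineMap.homothety x k⁻¹ y ∈ convexHull ℝ (t : Set E3) := by
        rw [← hT]
        apply closedBall_incenter_subset_convexHull T
        have : AffineMap.homothety x k⁻¹ y - T.incenter =
            k⁻¹ • (y - AffineMap.homothety x k T.incenter) := by
          simp only [AffineMap.homothety_apply, vsub_eq_sub, vadd_eq_add, smul_sub, smul_add,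
            inv_smul_smul₀ hk0.ne']
          abel
        rw [Metric.mem_closedBall, dist_eq_norm, this, norm_smul, Real.norm_of_nonneg
          (inv_nonneg.2 hk0.le), ← dist_eq_norm, inv_mul_le_iff₀ hk0, hkr]
        exact (Metric.mem_ball.1 hy).le
      have hyk : y = AffineMap.lineMap x (AffineMap.homothety x k⁻¹ y) k := by
        simp only [AffineMap.homothety_apply, AffineMap.lineMap_apply, vsub_eq_sub, vadd_eq_add,
          add_sub_cancel_right, smul_inv_smul₀ hk0.ne', sub_add_cancel]
      rw [hyk]
      exact (convex_convexHull ℝ _).lineMap_mem hx hy' ⟨hk0.le, hk1⟩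
    · have h1 : dist (AffineMap.homothety x k T.incenter) x = k * dist x T.incenter := by
        rw [dist_homothety_center, Real.norm_of_nonneg hk0.le]
      have h2 := dist_triangle (AffineMap.homothety x k T.incenter) x z
      have h3 := mul_le_mul_of_nonneg_left hreach hk0.le
      have h4 : k * (reach ρ * T.inradius) = reach ρ * r := by rw [← hkr]; ring
      rw [mul_add, hkr, h4] at h3
      linarith
  choose! c hc using hball
  refine card_mul_pow_le_of_disjoint_balls S hne c z hr ?_ fun t ht => (hc t ht).2
  intro s hs t ht hst
  exact disjoint_of_isOpen_subset_convexHull M (hS s hs) (hS t ht) hst Metric.isOpen_ball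
    Metric.isOpen_ball (hc s hs).1 (hc t ht).1

/-! ### Tetrahedra at the nearest vertex -/

lemma WellShaped.three_lt {M : Geometry.SimplicialComplex ℝ E3} {ρ : ℝ} (hρ : WellShaped M ρ)
    {t : Finset E3} (ht : t ∈ tetrahedra M) : 3 < ρ := by
  obtain ⟨T, hT⟩ := exists_simplex_range_eq M ht
  have h1 := hρ.circumradius_lt ht hT
  have h2 := three_mul_inradius_le_circumradius T
  exact lt_of_mul_lt_mul_right (h2.trans_lt h1) T.inradius_pos.le

/-- The number of tetrahedra at a vertex. They may have very different sizes, but shrinking about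
the vertex gives all of them the smallest of their inradii. -/
lemma card_le_reach_pow_of_mem (M : Geometry.SimplicialComplex ℝ E3) {ρ : ℝ}
    (hρ : WellShaped M ρ) (S : Finset (Finset E3)) (hne : S.Nonempty)
    (hS : ∀ t ∈ S, t ∈ tetrahedra M) {p : E3} (hp : ∀ t ∈ S, p ∈ t) :
    (S.card : ℝ) ≤ reach ρ ^ 3 := by
  have hT : ∀ t ∈ S, ∃ T : Affine.Simplex ℝ E3 3, Set.range T.points = (t : Set E3) :=
    fun t ht => exists_simplex_range_eq M (hS t ht)
  have hinh : Nonempty (Affine.Simplex ℝ E3 3) := ⟨(hT _ hne.choose_spec).choose⟩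
  choose! T hT using hT
  obtain ⟨t₀, -, hmin⟩ := S.exists_min_image (fun t => (T t).inradius) hne
  have hr := (T t₀).inradius_pos
  have h := card_mul_pow_le_of_inradius_ge M hρ S hne hS p (D := 0) hr fun t ht =>
    ⟨T t, hT t ht, hmin t ht, p, subset_convexHull ℝ _ (hp t ht), (dist_self p).le⟩
  rw [zero_add, mul_pow] at h
  exact le_of_mul_le_mul_right h (pow_pos hr 3)

/-- A segment inside the mesh that starts at a vertex `p` runs at first inside a tetrahedron with
vertex `p`, because the tetrahedra without the vertex `p` form a closed set that misses `p`. -/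
lemma exists_tetrahedron_of_segment_subset (M : Geometry.SimplicialComplex ℝ E3)
    (hM : IsTetrahedralMesh M) {p q : E3} (hp : p ∈ M.vertices)
    (hpq : segment ℝ p q ⊆ M.space) :
    ∃ t ∈ tetrahedra M, p ∈ t ∧ ∃ a : ℝ, 0 < a ∧
      AffineMap.lineMap p q a ∈ convexHull ℝ (t : Set E3) := by
  have hfin : {t | t ∈ tetrahedra M ∧ p ∉ t}.Finite := hM.finite.subset fun t ht => ht.1.1
  have hclosed : IsClosed (⋃ t ∈ {t | t ∈ tetrahedra M ∧ p ∉ t}, convexHull ℝ (t : Set E3)) :=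
    hfin.isClosed_biUnion fun t _ => t.finite_toSet.isClosed_convexHull ℝ
  have hpn : p ∉ ⋃ t ∈ {t | t ∈ tetrahedra M ∧ p ∉ t}, convexHull ℝ (t : Set E3) := by
    simp only [Set.mem_iUnion, not_exists]
    intro t ht hpt
    exact ht.2 ((M.vertex_mem_convexHull_iff hp ht.1.1).1 hpt)
  have hev : ∀ᶠ a : ℝ in nhds 0, AffineMap.lineMap p q a ∉
      ⋃ t ∈ {t | t ∈ tetrahedra M ∧ p ∉ t}, convexHull ℝ (t : Set E3) := by
    have hcont : Filter.Tendsto (fun a : ℝ => AffineMap.lineMap p q a) (nhds 0) (nhds p) := by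
      have := (AffineMap.lineMap_continuous (p := p) (q := q) (R := ℝ)).tendsto (0 : ℝ)
      rwa [AffineMap.lineMap_apply_zero] at this
    exact hcont (hclosed.isOpen_compl.mem_nhds hpn)
  obtain ⟨a, ha, ha0, ha1⟩ := ((hev.filter_mono nhdsWithin_le_nhds).and
    (Ioc_mem_nhdsGT (zero_lt_one' ℝ))).exists
  have hseg : AffineMap.lineMap p q a ∈ segment ℝ p q := by
    rw [segment_eq_image_lineMap]
    exact ⟨a, ⟨ha0.le, ha1⟩, rfl⟩
  obtain ⟨s, hs, hxs⟩ := Geometry.SimplicialComplex.mem_space_iff.1 (hpq hseg)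
  obtain ⟨t, ht, hst, hcard⟩ := hM.pure s hs
  have hxt := convexHull_mono (𝕜 := ℝ) (Finset.coe_subset.2 hst) hxs
  refine ⟨t, ⟨ht, hcard⟩, ?_, a, ha0, hxt⟩
  by_contra hpt
  exact ha (Set.mem_biUnion (⟨⟨ht, hcard⟩, hpt⟩ : t ∈ {t | t ∈ tetrahedra M ∧ p ∉ t}) hxt)

/-! ### Tetrahedra away from the nearest vertex -/

/-- A tetrahedron meets a simplex of the mesh without the vertex `T.points i` only in the face
opposite that vertex. -/
lemma coord_eq_zero_of_mem_convexHull (M : Geometry.SimplicialComplex ℝ E3)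
    {T : Affine.Simplex ℝ E3 3} {t₀ t : Finset E3} (ht₀ : t₀ ∈ M.faces) (ht : t ∈ M.faces)
    (hT : Set.range T.points = (t₀ : Set E3)) {i : Fin 4} (hi : T.points i ∉ t) {x : E3}
    (hx₀ : x ∈ convexHull ℝ (t₀ : Set E3)) (hx : x ∈ convexHull ℝ (t : Set E3)) :
    (baryBasis T).coord i x = 0 := by
  have hsub : convexHull ℝ (t₀ ∩ t : Set E3) ⊆ {y | (baryBasis T).coord i y = 0} := by
    refine convexHull_min ?_ ?_
    · rintro y ⟨hy₀, hy⟩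
      rw [← hT] at hy₀
      obtain ⟨j, rfl⟩ := hy₀
      have hij : i ≠ j := by
        rintro rfl
        exact hi hy
      exact (baryBasis T).coord_apply_ne hij
    · exact (convex_singleton (0 : ℝ)).affine_preimage ((baryBasis T).coord i)
  exact hsub (M.inter_subset_convexHull ht₀ ht ⟨hx₀, hx⟩)

lemma coord_lineMap (T : Affine.Simplex ℝ E3 3) (i j : Fin 4) (q : E3) (a : ℝ) :
    (baryBasis T).coord j (AffineMap.lineMap (T.points i) q a) =
      (1 - a) * (if j = i then 1 else 0) + a * (baryBasis T).coord j q := by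
  rw [AffineMap.apply_lineMap, ← baryBasis_apply, (baryBasis T).coord_apply,
    AffineMap.lineMap_apply_module]
  simp only [smul_eq_mul]

/-- The number of tetrahedra that meet the segment `pq` and do not have the vertex `p`. The
tetrahedron with vertex `p` along which the segment starts has size comparable to `|pq|`, since no
vertex lies inside the ball about `q` through `p`; the others meet `pq` behind the point `y` where
the segment leaves that tetrahedron, and they have circumradius at least `|py|`. -/
lemma card_le_of_notMem (M : Geometry.SimplicialComplex ℝ E3) (hM : IsTetrahedralMesh M) {ρ : ℝ}
    (hρ : WellShaped M ρ) {p q : E3} (hp : IsNearestVertex M p q)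
    (hpq : segment ℝ p q ⊆ M.space) (S : Finset (Finset E3)) (hne : S.Nonempty)
    (hS : ∀ t ∈ S, t ∈ visited M p q) (hpS : ∀ t ∈ S, p ∉ t) :
    (S.card : ℝ) ≤ (ρ ^ 3 / 16 + ρ / 4 + reach ρ) ^ 3 := by
  obtain ⟨t₀, ht₀, hpt₀, a, ha, hat₀⟩ := exists_tetrahedron_of_segment_subset M hM hp.1 hpq
  obtain ⟨T, hT⟩ := exists_simplex_range_eq M ht₀
  obtain ⟨i, rfl⟩ : p ∈ Set.range T.points := hT ▸ hpt₀
  set p := T.points i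
  set κ := (baryBasis T).coord i q
  have hvert : ∀ {t : Finset E3}, t ∈ tetrahedra M → ∀ {T' : Affine.Simplex ℝ E3 3},
      Set.range T'.points = (t : Set E3) → ∀ j, dist p q ≤ dist (T'.points j) q := by
    intro t ht T' hT' j
    refine hp.2 _ ?_
    have hj : T'.points j ∈ t := by
      rw [← Finset.mem_coe, ← hT']
      exact Set.mem_range_self j
    exact M.down_closed ht.1 (Finset.singleton_subset_iff.2 hj) (Finset.singleton_nonempty _)
  have hcoord_i : ∀ b, (baryBasis T).coord i (AffineMap.lineMap p q b) = 1 - b * (1 - κ) := by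
    intro b
    rw [coord_lineMap, if_pos rfl]
    ring
  have hcoord_nonneg : ∀ b, 0 ≤ b → b * (1 - κ) ≤ 1 →
      AffineMap.lineMap p q b ∈ convexHull ℝ (t₀ : Set E3) := by
    intro b hb hbκ
    rw [← hT, mem_convexHull_iff_coord_nonneg] at hat₀ ⊢
    intro j
    by_cases hj : j = i
    · rw [hj, hcoord_i]
      linarith
    · have := hat₀ j
      rw [coord_lineMap, if_neg hj, mul_zero, zero_add] at this ⊢
      exact mul_nonneg hb (nonneg_of_mul_nonneg_right this ha)
  -- The other tetrahedra are met only after the segment has left `t₀`.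
  have hfar : ∀ t ∈ S, ∃ b : ℝ, 0 ≤ b ∧ b ≤ 1 ∧ 1 ≤ b * (1 - κ) ∧
      AffineMap.lineMap p q b ∈ convexHull ℝ (t : Set E3) := by
    intro t ht
    obtain ⟨htet, x, hxt, hx⟩ := hS t ht
    rw [segment_eq_image_lineMap] at hx
    obtain ⟨b, ⟨hb0, hb1⟩, rfl⟩ := hx
    refine ⟨b, hb0, hb1, ?_, hxt⟩
    by_contra! hb
    have := coord_eq_zero_of_mem_convexHull M ht₀.1 htet.1 hT (hpS t ht)
      (hcoord_nonneg b hb0 hb.le) hxt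
    rw [hcoord_i] at this
    linarith
  have hα : 1 ≤ 1 - κ := by
    obtain ⟨t, ht⟩ := hne
    obtain ⟨b, hb0, hb1, hb, -⟩ := hfar t ht
    have hpos : 0 < 1 - κ := by
      by_contra! hneg
      linarith [mul_nonpos_of_nonneg_of_nonpos hb0 hneg]
    exact hb.trans (mul_le_of_le_one_left hpos.le hb1)
  have hα0 : 0 < 1 - κ := by linarith
  -- The segment leaves `t₀` at `y`, in the face opposite `p`.
  set y : E3 := AffineMap.lineMap p q (1 - κ)⁻¹ with hy
  set L := dist p q with hL
  set d := dist p y with hd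
  have hdL : d = (1 - κ)⁻¹ * L := by
    rw [hd, hy, dist_left_lineMap, Real.norm_of_nonneg (inv_nonneg.2 hα0.le)]
  have hLd : (1 - κ) * d = L := by rw [hdL, mul_inv_cancel_left₀ hα0.ne']
  have hyq : dist y q = L - d := by
    rw [hy, dist_lineMap_right, Real.norm_of_nonneg (sub_nonneg.2 (inv_le_one_of_one_le₀ hα)), hdL]
    ring
  have hyT : y ∈ convexHull ℝ (Set.range T.points) := by
    rw [hT]
    exact hcoord_nonneg _ (inv_nonneg.2 hα0.le) (inv_mul_cancel₀ hα0.ne').le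
  have hheight : T.height i ≤ d := by
    have h1 := abs_coord_sub_mul_height_le_dist T i p y
    have h2 : (baryBasis T).coord i p = 1 := (baryBasis T).coord_apply_eq i
    rwa [hy, hcoord_i, inv_mul_cancel₀ hα0.ne', sub_self, sub_zero, h2, one_mul,
      abs_of_pos (T.height_pos i)] at h1
  have hd0 : 0 < d := (T.height_pos i).trans_le hheight
  have hρ3 : 3 < ρ := hρ.three_lt ht₀
  have hLρ : 2 * L ≤ d * (1 + ρ ^ 2 / 4) := by
    have h1 := sq_le_dist_sq_add_circumradius_sq T dist_nonneg hyT (hvert ht₀ hT)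
    rw [hyq] at h1
    have h2 : T.circumradius ≤ ρ * (d / 2) := by
      refine (hρ.circumradius_lt ht₀ hT).le.trans ?_
      have := two_mul_inradius_lt_height T i
      exact mul_le_mul_of_nonneg_left (by linarith) (by linarith)
    have h3 := pow_le_pow_left₀ T.circumradius_nonneg h2 2
    have h4 : d * (2 * L) ≤ d * (d * (1 + ρ ^ 2 / 4)) := by nlinarith
    exact le_of_mul_le_mul_left h4 hd0
  have hcount := card_mul_pow_le_of_inradius_ge M hρ S hne (fun t ht => (hS t ht).1)
    (midpoint ℝ p q) (r := d / ρ) (D := L / 2) (div_pos hd0 (by linarith)) (by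
      intro t ht
      obtain ⟨b, hb0, hb1, hb, hbt⟩ := hfar t ht
      have htet := (hS t ht).1
      obtain ⟨T', hT'⟩ := exists_simplex_range_eq M htet
      have hpx : dist p (AffineMap.lineMap p q b) = b * L := by
        rw [dist_left_lineMap, Real.norm_of_nonneg hb0]
      have hxq : dist (AffineMap.lineMap p q b) q = (1 - b) * L := by
        rw [dist_lineMap_right, Real.norm_of_nonneg (sub_nonneg.2 hb1)]
      refine ⟨T', hT', ?_, _, hbt, ?_⟩
      · have h1 : ∀ j, b * L ≤ dist (T'.points j) (AffineMap.lineMap p q b) := by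
          intro j
          have h2 := hvert htet hT' j
          have h3 := dist_triangle (T'.points j) (AffineMap.lineMap p q b) q
          rw [hxq] at h3
          linarith
        have h2 := sq_le_dist_sq_add_circumradius_sq T' (mul_nonneg hb0 dist_nonneg)
          (hT' ▸ hbt) h1
        rw [dist_self] at h2
        have h3 : b * L ≤ T'.circumradius :=
          abs_le_of_sq_le_sq' (by linarith) T'.circumradius_nonneg |>.2
        have h4 : d ≤ b * L := by
          rw [← hLd]
          nlinarith
        rw [div_le_iff₀ (by linarith)]
        linarith [hρ.circumradius_lt htet hT']
      · rw [← lineMap_inv_two, dist_lineMap_lineMap, ← hL, Real.dist_eq, mul_comm]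
        have : |b - 2⁻¹| ≤ 1 / 2 := abs_le.2 ⟨by linarith, by linarith⟩
        nlinarith [dist_nonneg (x := p) (y := q)])
  have hr : 0 < d / ρ := div_pos hd0 (by linarith)
  have hbound : L / 2 + reach ρ * (d / ρ) ≤ (ρ ^ 3 / 16 + ρ / 4 + reach ρ) * (d / ρ) := by
    have : (ρ ^ 3 / 16 + ρ / 4) * (d / ρ) = d * (1 + ρ ^ 2 / 4) / 4 := by
      field_simp
      ring
    rw [add_mul, this]
    linarith
  have hreach : 0 ≤ reach ρ := by
    rw [reach]
    nlinarith
  have h1 := hcount.trans (pow_le_pow_left₀ (by positivity) hbound 3)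
  rw [mul_pow] at h1
  exact le_of_mul_le_mul_right h1 (pow_pos hr 3)

/-! ### The numerical bound -/

lemma reach_pow_add_le {ρ : ℝ} (hρ : 3 ≤ ρ) :
    reach ρ ^ 3 + (ρ ^ 3 / 16 + ρ / 4 + reach ρ) ^ 3 ≤ (2 / 9 * (ρ * (ρ ^ 2 + 3))) ^ 3 := by
  obtain ⟨u, rfl⟩ : ∃ u, ρ = 3 + u := ⟨ρ - 3, by ring⟩
  have hu : 0 ≤ u := by linarith
  rw [reach, ← sub_nonneg]
  ring_nf
  positivity

lemma two_ninths_pow_le : ((2 : ℝ) / 9) ^ 3 ≤ √3 * Real.pi / 486 := by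
  have h1 : (1.7 : ℝ) ≤ √3 := Real.le_sqrt_of_sq_le (by norm_num)
  have h2 := Real.pi_gt_d2
  have h3 : (1.7 : ℝ) * 3.14 ≤ √3 * Real.pi := by gcongr
  norm_num at h3 ⊢
  linarith

end TetMesh

theorem mainTheorem9 (M : Geometry.SimplicialComplex ℝ TetMesh.E3)
    (hM : TetMesh.IsTetrahedralMesh M) (ρ : ℝ) (hρ : TetMesh.WellShaped M ρ)
    (p q : TetMesh.E3) (hp : TetMesh.IsNearestVertex M p q)
    (hpq : segment ℝ p q ⊆ M.space) :
    ((TetMesh.visited M p q).ncard : ℝ) ≤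
      Real.sqrt 3 * Real.pi / 486 * ρ ^ 3 * (ρ ^ 2 + 3) ^ 3 := by
  classical
  have hfin : (TetMesh.visited M p q).Finite := hM.finite.subset fun t ht => ht.1.1
  obtain ⟨t₀, ht₀, hpt₀, -⟩ := TetMesh.exists_tetrahedron_of_segment_subset M hM hp.1 hpq
  have hρ3 : 3 < ρ := hρ.three_lt ht₀
  have hreach : 0 ≤ TetMesh.reach ρ := by
    rw [TetMesh.reach]
    nlinarith
  set S := hfin.toFinset
  have hSv : ∀ t ∈ S, t ∈ TetMesh.visited M p q := fun t ht => hfin.mem_toFinset.1 ht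
  have h1 : ((S.filter fun t => p ∈ t).card : ℝ) ≤ TetMesh.reach ρ ^ 3 := by
    rcases (S.filter fun t => p ∈ t).eq_empty_or_nonempty with h | h
    · rw [h, Finset.card_empty, Nat.cast_zero]
      positivity
    · exact TetMesh.card_le_reach_pow_of_mem M hρ _ h
        (fun t ht => (hSv t (Finset.mem_filter.1 ht).1).1) fun t ht => (Finset.mem_filter.1 ht).2
  have h2 : ((S.filter fun t => p ∉ t).card : ℝ) ≤
      (ρ ^ 3 / 16 + ρ / 4 + TetMesh.reach ρ) ^ 3 := by
    rcases (S.filter fun t => p ∉ t).eq_empty_or_nonempty with h | h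
    · rw [h, Finset.card_empty, Nat.cast_zero]
      positivity
    · exact TetMesh.card_le_of_notMem M hM hρ hp hpq _ h
        (fun t ht => hSv t (Finset.mem_filter.1 ht).1) fun t ht => (Finset.mem_filter.1 ht).2
  have h3 : ((TetMesh.visited M p q).ncard : ℝ) =
      (S.filter fun t => p ∈ t).card + (S.filter fun t => p ∉ t).card := by
    rw [Set.ncard_eq_toFinset_card _ hfin, ← Nat.cast_add, Finset.card_filter_add_card_filter_not]
  calc ((TetMesh.visited M p q).ncard : ℝ)
      ≤ TetMesh.reach ρ ^ 3 + (ρ ^ 3 / 16 + ρ / 4 + TetMesh.reach ρ) ^ 3 := by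
        rw [h3]; exact add_le_add h1 h2
    _ ≤ (2 / 9 * (ρ * (ρ ^ 2 + 3))) ^ 3 := TetMesh.reach_pow_add_le hρ3.le
    _ = (2 / 9) ^ 3 * (ρ * (ρ ^ 2 + 3)) ^ 3 := mul_pow _ _ _
    _ ≤ √3 * Real.pi / 486 * (ρ * (ρ ^ 2 + 3)) ^ 3 := by
        gcongr
        exact TetMesh.two_ninths_pow_le
    _ = √3 * Real.pi / 486 * ρ ^ 3 * (ρ ^ 2 + 3) ^ 3 := by ring
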